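/- Let $(\Omega,\mathcal F,\mathbb P)$ be a complete probability space carrying a standard one-dimensional Brownian motion $W$, let $\mathbb F=\{\mathcal F_t\}_{t\ge0}$ be the usual augmentation of the natural filtration of $W$, and let $T>0$. For $i=1,2$ let $\mathcal U_i[0,T]$ be the set of $\mathbb F$-progressively measurable processes $u:[0,T]\times\Omega\to\mathbb R^{m_i}$ with $\mathbb E\int_0^T|u(t)|^2dt<\infty$. Let $A,C\in L^\infty(0,T;\mathbb R^{n\times n})$, $B_i,D_i\in L^\infty(0,T;\mathbb R^{n\times m_i})$, $S_i\in L^\infty(0,T;\mathbb R^{m_i\times n})$, $R_{ij}\in L^\infty(0,T;\mathbb R^{m_i\times m_j})$ with $R_{ij}^\top=R_{ji}$ $(i,j=1,2)$, let $Q\in L^\infty(0,T;\mathbb R^{n\times n})$ take symmetric values, and let $G\in\mathbb R^{n\times n}$ be symmetric. For $x\in\mathbb R^n$ and $(u_1,u_2)\in\mathcal U_1[0,T]\times\mathcal U_2[0,T]$ let $X$ be the solution of $$dX=[AX+B_1u_1+B_2u_2]\,dt+[CX+D_1u_1+D_2u_2]\,dW,\quad t\in[0,T],\qquad X(0)=x,$$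 and let $$J(x;u_1,u_2)=\mathbb E\left\{\langle GX(T),X(T)\rangle+\int_0^T\left\langle\begin{pmatrix}Q&S_1^\top&S_2^\top\\S_1&R_{11}&R_{12}\\S_2&R_{21}&R_{22}\end{pmatrix}\begin{pmatrix}X\\u_1\\u_2\end{pmatrix},\begin{pmatrix}X\\u_1\\u_2\end{pmatrix}\right\rangle dt\right\}.$$ Define the open-loop lower and upper values, with values in $[-\infty,\infty]$, by $$V^-(x)=\sup_{u_2\in\mathcal U_2[0,T]}\ \inf_{u_1\in\mathcal U_1[0,T]}J(x;u_1,u_2),\qquad V^+(x)=\inf_{u_1\in\mathcal U_1[0,T]}\ \sup_{u_2\in\mathcal U_2[0,T]}J(x;u_1,u_2);$$ if $V^-(x)=V^+(x)$, the common value $V(x)$ is called the open-loop value at $x$. Suppose that, for some $x\in\mathbb R^n$, the pair $(u_1^*,u_2^*)\in\mathcal U_1[0,T]\times\mathcal U_2[0,T]$ is an open-loop saddle point for the initial state $x$, that is, $$J(x;u_1^*,u_2)\le J(x;u_1^*,u_2^*)\le J(x;u_1,u_2^*)\qquad\text{for all }(u_1,u_2)\in\mathcal U_1[0,T]\times\mathcal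 U_2[0,T].$$ Then the game has a finite open-loop value at $x$, i.e. $V^-(x)=V^+(x)\in\mathbb R$, and $V(x)=J(x;u_1^*,u_2^*)$. -/

import Mathlib

open MeasureTheory ProbabilityTheory Filter Topology Matrix
open scoped NNReal ENNReal

namespace SLQGame

/-! ### The filtration of the Brownian motion -/

section Filtration

variable {Ω : Type*} [mΩ : MeasurableSpace Ω]

/-- The filtration obtained from `𝓕` by adding all `P`-null sets to every `𝓕 t`. -/
def nullAugmentation (𝓕 : Filtration ℝ≥0 mΩ) (P : Measure Ω) [P.IsComplete] :
    Filtration ℝ≥0 mΩ where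
  seq t := 𝓕 t ⊔ MeasurableSpace.generateFrom {N | P N = 0}
  mono' _ _ hst := sup_le_sup_right (𝓕.mono hst) _
  le' t := sup_le (𝓕.le t)
    (MeasurableSpace.generateFrom_le fun _ hN => measurableSet_of_null hN)

/-- The usual augmentation of the natural filtration of the process `W`: the null sets are added
to the natural filtration, and the right-continuous version is taken. -/
noncomputable def usualFiltration (P : Measure Ω) [P.IsComplete] (W : ℝ≥0 → Ω → ℝ)
    (hW : ∀ t, Measurable (W t)) : Filtration ℝ≥0 mΩ :=
  (nullAugmentation (Filtration.natural W fun t => (hW t).stronglyMeasurable) P).rightCont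

end Filtration

/-! ### The time interval, square-integrable processes and the space of controls

Processes are indexed by `ℝ≥0`; only their values on `[0,T]` matter. -/

/-- Lebesgue measure on the time interval `[0,T]`. -/
noncomputable def timeMeasure (T : ℝ≥0) : Measure ℝ≥0 :=
  (volume.comap ((↑) : ℝ≥0 → ℝ)).restrict (Set.Iic T)

section Processes

variable {Ω : Type*} [mΩ : MeasurableSpace Ω]

/-- `φ` belongs to `L²([0,T] × Ω, dt ⊗ P)`, that is, `E ∫₀ᵀ |φ(t)|² dt < ∞`. -/
def SqIntegrable (P : Measure Ω) (T : ℝ≥0) {E : Type*} [NormedAddCommGroup E]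
    (φ : ℝ≥0 → Ω → E) : Prop :=
  MemLp (fun p : ℝ≥0 × Ω => φ p.1 p.2) 2 ((timeMeasure T).prod P)

/-- The space `𝒰[0,T]` of `ℝᵏ`-valued controls: progressively measurable processes `φ` with
`E ∫₀ᵀ |φ(t)|² dt < ∞`. -/
def controls (P : Measure Ω) (𝓕 : Filtration ℝ≥0 mΩ) (T : ℝ≥0) (k : ℕ) :
    Set (ℝ≥0 → Ω → EuclideanSpace ℝ (Fin k)) :=
  {φ | IsStronglyProgressive 𝓕 φ ∧ SqIntegrable P T φ}

/-! ### The Itô integral of square-integrable processes -/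

/-- A simple process: a finite sum of the processes `val k · 1_{(time k, time (k+1)]}`, `k < N`,
where `val k` is bounded and `𝓕 (time k)`-measurable. -/
structure SimpleProcess (𝓕 : Filtration ℝ≥0 mΩ) where
  N : ℕ
  time : ℕ → ℝ≥0
  time_mono : Monotone time
  val : ℕ → Ω → ℝ
  val_measurable : ∀ k, Measurable[𝓕 (time k)] (val k)
  val_bounded : ∀ k, ∃ c : ℝ, ∀ ω, |val k ω| ≤ c

/-- The process `∑_{k < N} val k · 1_{(time k, time (k+1)]}`. -/
noncomputable def SimpleProcess.toFun {𝓕 : Filtration ℝ≥0 mΩ} (S : SimpleProcess 𝓕)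
    (t : ℝ≥0) (ω : Ω) : ℝ :=
  ∑ k ∈ Finset.range S.N, (Set.Ioc (S.time k) (S.time (k + 1))).indicator (fun _ => S.val k ω) t

/-- The stochastic integral `∫₀ᵗ S dW` of a simple process. -/
noncomputable def SimpleProcess.integral {𝓕 : Filtration ℝ≥0 mΩ} (S : SimpleProcess 𝓕)
    (W : ℝ≥0 → Ω → ℝ) (t : ℝ≥0) (ω : Ω) : ℝ :=
  ∑ k ∈ Finset.range S.N,
    S.val k ω * (W (min (S.time (k + 1)) t) ω - W (min (S.time k) t) ω)

/-- `M` is (a version of) the Itô integral process `M(t) = ∫₀ᵗ φ dW`, `t ∈ [0,T]`, of the scalar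
process `φ`: for some simple processes `S₀, S₁, …` converging to `φ` in `L²([0,T] × Ω)`, the
integrals `∫₀ᵗ Sⱼ dW` converge to `M(t)` in `L²(Ω)` for every `t ∈ [0,T]`. -/
def IsItoIntegral (P : Measure Ω) (𝓕 : Filtration ℝ≥0 mΩ) (W : ℝ≥0 → Ω → ℝ) (T : ℝ≥0)
    (φ M : ℝ≥0 → Ω → ℝ) : Prop :=
  SqIntegrable P T φ ∧ (∀ t ≤ T, MemLp (M t) 2 P) ∧
  ∃ S : ℕ → SimpleProcess 𝓕,
    Tendsto (fun j => eLpNorm (fun p : ℝ≥0 × Ω => (S j).toFun p.1 p.2 - φ p.1 p.2) 2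
      ((timeMeasure T).prod P)) atTop (𝓝 0) ∧
    ∀ t ≤ T, Tendsto (fun j => eLpNorm (fun ω => (S j).integral W t ω - M t ω) 2 P) atTop (𝓝 0)

end Processes

/-! ### The game -/

/-- The data of the game: the coefficients `A, B₁, B₂, C, D₁, D₂` of the state equation and the
weights `G, Q, Sᵢ, Rᵢⱼ` of the quadratic functional. Only the values on `[0,T]` matter. -/
structure Data (n m₁ m₂ : ℕ) where
  A : ℝ≥0 → Matrix (Fin n) (Fin n) ℝ
  B₁ : ℝ≥0 → Matrix (Fin n) (Fin m₁) ℝ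
  B₂ : ℝ≥0 → Matrix (Fin n) (Fin m₂) ℝ
  C : ℝ≥0 → Matrix (Fin n) (Fin n) ℝ
  D₁ : ℝ≥0 → Matrix (Fin n) (Fin m₁) ℝ
  D₂ : ℝ≥0 → Matrix (Fin n) (Fin m₂) ℝ
  G : Matrix (Fin n) (Fin n) ℝ
  Q : ℝ≥0 → Matrix (Fin n) (Fin n) ℝ
  S₁ : ℝ≥0 → Matrix (Fin m₁) (Fin n) ℝ
  S₂ : ℝ≥0 → Matrix (Fin m₂) (Fin n) ℝ
  R₁₁ : ℝ≥0 → Matrix (Fin m₁) (Fin m₁) ℝ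
  R₁₂ : ℝ≥0 → Matrix (Fin m₁) (Fin m₂) ℝ
  R₂₁ : ℝ≥0 → Matrix (Fin m₂) (Fin m₁) ℝ
  R₂₂ : ℝ≥0 → Matrix (Fin m₂) (Fin m₂) ℝ

/-- The matrix-valued function `M` belongs to `L^∞(0,T)`: its entries are Lebesgue measurable and
essentially bounded on `[0,T]`. -/
def IsLInfty (T : ℝ≥0) {k l : ℕ} (M : ℝ≥0 → Matrix (Fin k) (Fin l) ℝ) : Prop :=
  ∀ i j, MemLp (fun t => M t i j) ∞ (timeMeasure T)

namespace Data

variable {n m₁ m₂ : ℕ} (𝒢 : Data n m₁ m₂)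

/-- The assumption on the coefficients of the state equation. -/
structure CoefficientAssumption (T : ℝ≥0) : Prop where
  A : IsLInfty T 𝒢.A
  B₁ : IsLInfty T 𝒢.B₁
  B₂ : IsLInfty T 𝒢.B₂
  C : IsLInfty T 𝒢.C
  D₁ : IsLInfty T 𝒢.D₁
  D₂ : IsLInfty T 𝒢.D₂

/-- The assumption on the weighting matrices of the quadratic functional. -/
structure WeightAssumption (T : ℝ≥0) : Prop where
  Q : IsLInfty T 𝒢.Q
  S₁ : IsLInfty T 𝒢.S₁
  S₂ : IsLInfty T 𝒢.S₂
  R₁₁ : IsLInfty T 𝒢.R₁₁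
  R₁₂ : IsLInfty T 𝒢.R₁₂
  R₂₁ : IsLInfty T 𝒢.R₂₁
  R₂₂ : IsLInfty T 𝒢.R₂₂
  G_symm : 𝒢.Gᵀ = 𝒢.G
  Q_symm : ∀ t ≤ T, (𝒢.Q t)ᵀ = 𝒢.Q t
  R₁₁_symm : ∀ t ≤ T, (𝒢.R₁₁ t)ᵀ = 𝒢.R₁₁ t
  R₁₂_symm : ∀ t ≤ T, (𝒢.R₁₂ t)ᵀ = 𝒢.R₂₁ t
  R₂₂_symm : ∀ t ≤ T, (𝒢.R₂₂ t)ᵀ = 𝒢.R₂₂ t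

/-- The drift `A(t) x + B₁(t) u₁ + B₂(t) u₂`. -/
noncomputable def drift (t : ℝ≥0) (x : EuclideanSpace ℝ (Fin n)) (u₁ : EuclideanSpace ℝ (Fin m₁))
    (u₂ : EuclideanSpace ℝ (Fin m₂)) : EuclideanSpace ℝ (Fin n) :=
  WithLp.toLp 2 (𝒢.A t *ᵥ x.ofLp + 𝒢.B₁ t *ᵥ u₁.ofLp + 𝒢.B₂ t *ᵥ u₂.ofLp)

/-- The diffusion coefficient `C(t) x + D₁(t) u₁ + D₂(t) u₂`. -/
noncomputable def diffusion (t : ℝ≥0) (x : EuclideanSpace ℝ (Fin n))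
    (u₁ : EuclideanSpace ℝ (Fin m₁)) (u₂ : EuclideanSpace ℝ (Fin m₂)) :
    EuclideanSpace ℝ (Fin n) :=
  WithLp.toLp 2 (𝒢.C t *ᵥ x.ofLp + 𝒢.D₁ t *ᵥ u₁.ofLp + 𝒢.D₂ t *ᵥ u₂.ofLp)

/-- The symmetric block matrix `(Q, S₁ᵀ, S₂ᵀ; S₁, R₁₁, R₁₂; S₂, R₂₁, R₂₂)` at time `t`. -/
def weight (t : ℝ≥0) : Matrix (Fin n ⊕ (Fin m₁ ⊕ Fin m₂)) (Fin n ⊕ (Fin m₁ ⊕ Fin m₂)) ℝ :=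
  fromBlocks (𝒢.Q t) (fromCols (𝒢.S₁ t)ᵀ (𝒢.S₂ t)ᵀ) (fromRows (𝒢.S₁ t) (𝒢.S₂ t))
    (fromBlocks (𝒢.R₁₁ t) (𝒢.R₁₂ t) (𝒢.R₂₁ t) (𝒢.R₂₂ t))

/-- The running payoff: the quadratic form of `weight t` at the stacked vector `(x, u₁, u₂)`. -/
noncomputable def runningPayoff (t : ℝ≥0) (x : EuclideanSpace ℝ (Fin n))
    (u₁ : EuclideanSpace ℝ (Fin m₁)) (u₂ : EuclideanSpace ℝ (Fin m₂)) : ℝ :=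
  let v : Fin n ⊕ (Fin m₁ ⊕ Fin m₂) → ℝ := Sum.elim x.ofLp (Sum.elim u₁.ofLp u₂.ofLp)
  (𝒢.weight t *ᵥ v) ⬝ᵥ v

section Stochastic

variable {Ω : Type*} [mΩ : MeasurableSpace Ω] (P : Measure Ω) (𝓕 : Filtration ℝ≥0 mΩ)
  (W : ℝ≥0 → Ω → ℝ) (T : ℝ≥0)

/-- `X` is a solution of the state equation
`dX = (A X + B₁ u₁ + B₂ u₂) dt + (C X + D₁ u₁ + D₂ u₂) dW` on `[0,T]` with `X(0) = x`:
a progressively measurable, square-integrable process with almost surely continuous paths that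
satisfies the integrated equation, almost surely for all `t ∈ [0,T]`. -/
structure IsState (x : EuclideanSpace ℝ (Fin n)) (u₁ : ℝ≥0 → Ω → EuclideanSpace ℝ (Fin m₁))
    (u₂ : ℝ≥0 → Ω → EuclideanSpace ℝ (Fin m₂)) (X : ℝ≥0 → Ω → EuclideanSpace ℝ (Fin n)) :
    Prop where
  progressive : IsStronglyProgressive 𝓕 X
  continuous : ∀ᵐ ω ∂P, ContinuousOn (fun t => X t ω) (Set.Iic T)
  sqIntegrable : SqIntegrable P T X
  equation : ∃ M : ℝ≥0 → Ω → EuclideanSpace ℝ (Fin n),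
    (∀ i, IsItoIntegral P 𝓕 W T (fun t ω => 𝒢.diffusion t (X t ω) (u₁ t ω) (u₂ t ω) i)
      (fun t ω => M t ω i)) ∧
    ∀ᵐ ω ∂P, ∀ t ≤ T,
      X t ω = x + (∫ s, 𝒢.drift s (X s ω) (u₁ s ω) (u₂ s ω) ∂timeMeasure t) + M t ω

open Classical in
/-- The state process `X` with initial state `x` and controls `u₁, u₂`. The solution of the state
equation is unique up to indistinguishability, so that it does not matter which version is
chosen. -/
noncomputable def state (x : EuclideanSpace ℝ (Fin n))
    (u₁ : ℝ≥0 → Ω → EuclideanSpace ℝ (Fin m₁)) (u₂ : ℝ≥0 → Ω → EuclideanSpace ℝ (Fin m₂)) :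
    ℝ≥0 → Ω → EuclideanSpace ℝ (Fin n) :=
  if h : ∃ X, 𝒢.IsState P 𝓕 W T x u₁ u₂ X then h.choose else 0

/-- The quadratic functional
`J(x; u₁, u₂) = E { ⟨G X(T), X(T)⟩ + ∫₀ᵀ ⟨weight (X, u₁, u₂), (X, u₁, u₂)⟩ dt }`. -/
noncomputable def J (x : EuclideanSpace ℝ (Fin n))
    (u₁ : ℝ≥0 → Ω → EuclideanSpace ℝ (Fin m₁)) (u₂ : ℝ≥0 → Ω → EuclideanSpace ℝ (Fin m₂)) : ℝ :=
  let X := 𝒢.state P 𝓕 W T x u₁ u₂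
  ∫ ω, ((𝒢.G *ᵥ (X T ω).ofLp) ⬝ᵥ (X T ω).ofLp +
    ∫ t, 𝒢.runningPayoff t (X t ω) (u₁ t ω) (u₂ t ω) ∂timeMeasure T) ∂P

/-- `(u₁, u₂)` is an open-loop saddle point for the initial state `x`. -/
def IsSaddlePoint (x : EuclideanSpace ℝ (Fin n))
    (u₁ : ℝ≥0 → Ω → EuclideanSpace ℝ (Fin m₁)) (u₂ : ℝ≥0 → Ω → EuclideanSpace ℝ (Fin m₂)) :
    Prop :=
  u₁ ∈ controls P 𝓕 T m₁ ∧ u₂ ∈ controls P 𝓕 T m₂ ∧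
  ∀ v₁ ∈ controls P 𝓕 T m₁, ∀ v₂ ∈ controls P 𝓕 T m₂,
    𝒢.J P 𝓕 W T x u₁ v₂ ≤ 𝒢.J P 𝓕 W T x u₁ u₂ ∧
    𝒢.J P 𝓕 W T x u₁ u₂ ≤ 𝒢.J P 𝓕 W T x v₁ u₂

/-- The open-loop lower value `V⁻(x) = sup_{u₂} inf_{u₁} J(x; u₁, u₂)`, an extended real. -/
noncomputable def lowerValue (x : EuclideanSpace ℝ (Fin n)) : EReal :=
  ⨆ u₂ ∈ controls P 𝓕 T m₂, ⨅ u₁ ∈ controls P 𝓕 T m₁, (𝒢.J P 𝓕 W T x u₁ u₂ : EReal)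

/-- The open-loop upper value `V⁺(x) = inf_{u₁} sup_{u₂} J(x; u₁, u₂)`, an extended real. -/
noncomputable def upperValue (x : EuclideanSpace ℝ (Fin n)) : EReal :=
  ⨅ u₁ ∈ controls P 𝓕 T m₁, ⨆ u₂ ∈ controls P 𝓕 T m₂, (𝒢.J P 𝓕 W T x u₁ u₂ : EReal)

/-- The game has the open-loop value `v` at `x`: `V⁻(x) = V⁺(x)`, and `v` is this common value. -/
def IsOpenLoopValue (x : EuclideanSpace ℝ (Fin n)) (v : EReal) : Prop :=
  𝒢.lowerValue P 𝓕 W T x = v ∧ 𝒢.upperValue P 𝓕 W T x = v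

end Stochastic

end Data

end SLQGame

/-! The argument is purely order-theoretic: the stochastic dynamics enter only through the
real-valued payoff `J`. Freezing the minimiser at the saddle control bounds both values above by the
saddle payoff, because the other player then cannot exceed it; freezing the maximiser bounds both
below. These four estimates give both equalities directly, without a separate appeal to weak
duality. Finiteness is automatic, since the common value is the coercion to `EReal` of a real
number. -/

/-- If the pair `(a, b) ∈ A × B` is a saddle point on `A × B` of the real-valued function `f`,
then the lower value and the upper value of `f` both equal `f a b`. -/
theorem minimax_eq_of_saddlePoint {α β : Type*} {A : Set α} {B : Set β} {f : α → β → ℝ}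
    {a : α} {b : β} (ha : a ∈ A) (hb : b ∈ B) (hmax : ∀ b' ∈ B, f a b' ≤ f a b)
    (hmin : ∀ a' ∈ A, f a b ≤ f a' b) :
    (⨆ b' ∈ B, ⨅ a' ∈ A, (f a' b' : EReal)) = f a b ∧
      (⨅ a' ∈ A, ⨆ b' ∈ B, (f a' b' : EReal)) = f a b := by
  refine ⟨le_antisymm ?_ ?_, le_antisymm ?_ ?_⟩
  -- Upper bounds, here and in the third bullet: the infimum is tested at `a`, and `hmax` controls
  -- every response `b'`.
  · exact iSup₂_le fun b' hb' => (iInf₂_le a ha).trans (EReal.coe_le_coe_iff.2 (hmax b' hb'))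
  -- Lower bounds, here and in the last bullet: the supremum is tested at `b`, and `hmin` controls
  -- every `a'`.
  · exact le_iSup₂_of_le b hb (le_iInf₂ fun a' ha' => EReal.coe_le_coe_iff.2 (hmin a' ha'))
  · exact iInf₂_le_of_le a ha (iSup₂_le fun b' hb' => EReal.coe_le_coe_iff.2 (hmax b' hb'))
  · exact le_iInf₂ fun a' ha' =>
      (EReal.coe_le_coe_iff.2 (hmin a' ha')).trans
        (le_iSup₂ (f := fun b' (_ : b' ∈ B) => (f a' b' : EReal)) b hb)

theorem mainTheorem8 {Ω : Type*} [mΩ : MeasurableSpace Ω] (P : Measure Ω)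
    [IsProbabilityMeasure P] [P.IsComplete] (W : ℝ≥0 → Ω → ℝ) (hWm : ∀ t, Measurable (W t))
    (hW : IsBrownianReal W P) (T : ℝ≥0) (hT : 0 < T) {n m₁ m₂ : ℕ}
    (𝒢 : SLQGame.Data n m₁ m₂) (hA1 : 𝒢.CoefficientAssumption T) (hA2 : 𝒢.WeightAssumption T)
    (x : EuclideanSpace ℝ (Fin n)) (u₁ : ℝ≥0 → Ω → EuclideanSpace ℝ (Fin m₁))
    (u₂ : ℝ≥0 → Ω → EuclideanSpace ℝ (Fin m₂))
    (hu : 𝒢.IsSaddlePoint P (SLQGame.usualFiltration P W hWm) W T x u₁ u₂) :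
    ∃ v : ℝ, 𝒢.IsOpenLoopValue P (SLQGame.usualFiltration P W hWm) W T x (v : EReal) ∧
      v = 𝒢.J P (SLQGame.usualFiltration P W hWm) W T x u₁ u₂ := by
  obtain ⟨hu₁, hu₂, hsaddle⟩ := hu
  -- The saddle condition quantifies over both deviations at once. Each one-sided inequality
  -- involves only one of them, so the other slot is filled with the saddle control itself, which is
  -- admissible.
  exact ⟨_, minimax_eq_of_saddlePoint hu₁ hu₂ (fun v₂ hv₂ => (hsaddle u₁ hu₁ v₂ hv₂).1)
    (fun v₁ hv₁ => (hsaddle v₁ hv₁ u₂ hu₂).2), rfl⟩
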